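/- Work over the rational timeline $\mathbb{Q}$ and fix a countably infinite set of propositions. An interval is a set of rationals $\langle a,b\rangle$ given by two endpoints in $\mathbb{Q}\cup\{-\infty,\infty\}$, each finite endpoint being included or excluded; it is bounded if both endpoints are rational. Metric atoms are given by $$M ::= \top \mid \bot \mid p \mid \Diamond^-_\varrho M \mid \Diamond^+_\varrho M \mid \Box^-_\varrho M \mid \Box^+_\varrho M \mid M\,\mathcal{S}_\varrho M \mid M\,\mathcal{U}_\varrho M,$$ where $p$ is a proposition and $\varrho$ is a non-empty interval without negative elements. An interpretation $\mathfrak{I}$ assigns to each $t\in\mathbb{Q}$ a set of propositions, and satisfaction $\mathfrak{I},t\models M$ is defined as usual: $\top$ always holds and $\bot$ never does; $p$ holds at $t$ if $p\in\mathfrak{I}(t)$; $\Diamond^-_\varrho M$ (resp. $\Box^-_\varrho M$) holds at $t$ if $M$ holds at some (resp. every) $t'$ with $t-t'\in\varrho$; $M_1\mathcal{S}_\varrho M_2$ holds at $t$ if there is $t'$ with $t-t'\in\varrho$ such that $M_2$ holds at $t'$ and $M_1$ holds at all $t''\in(t',t)$; and $\Diamond^+$, $\Box^+$, $\mathcal{U}$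 are the mirror images towards the future. A propositional DatalogMTL$^\neg$ program $\Pi$ is a finite set of rules $$M \leftarrow M_1\wedge\dots\wedge M_k\wedge \mathsf{not}\,M_{k+1}\wedge\dots\wedge\mathsf{not}\,M_m \qquad (m\ge k\ge 0),$$ where the $M_i$ are metric atoms and the head $M$ is built from $\top$, $\bot$ and propositions using only $\Box^-_\varrho$ and $\Box^+_\varrho$. It is forward-propagating if $\Diamond^+,\Box^+,\mathcal{U}$ do not occur in rule bodies and $\Box^-$ does not occur in rule heads. A dataset $\mathcal{D}$ is a finite set of facts $p@\varrho$ with $p$ a proposition and $\varrho$ a non-empty interval; it is bounded if all these intervals are. An interpretation is a model of $\mathcal{D}$ if $p$ holds at every $t\in\varrho$, for each $p@\varrho$ in $\mathcal{D}$. For interpretations $\mathfrak{H}\subseteq\mathfrak{T}$ (pointwise), the pair $(\mathfrak{H},\mathfrak{T})$ is an HT-model of $\Pi$ and $\mathcal{D}$ if $\mathfrak{H}$ is a model of $\mathcal{D}$ and, for each rule as above, each $t\in\mathbb{Q}$ and each $\mathfrak{J}\in\{\mathfrak{H},\mathfrak{T}\}$: if $\mathfrak{J},t\models M_i$ for all $i\le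 k$ and $\mathfrak{T},t\not\models M_j$ for all $j$ with $k<j\le m$, then $\mathfrak{J},t\models M$. An interpretation $\mathfrak{T}$ is a stable model of $\Pi$ and $\mathcal{D}$ if $(\mathfrak{T},\mathfrak{T})$ is an HT-model of $\Pi$ and $\mathcal{D}$ and $\mathfrak{T}$ is the least interpretation $\mathfrak{H}$ such that $(\mathfrak{H},\mathfrak{T})$ is an HT-model of $\Pi$ and $\mathcal{D}$. **Theorem.** Checking whether a propositional forward-propagating DatalogMTL$^\neg$ program and a bounded dataset have a stable model over the rational timeline is undecidable with respect to data complexity. That is, there is a fixed propositional forward-propagating program $\Pi$ for which no algorithm, given as its input a bounded dataset $\mathcal{D}$ (a finite list of facts, with the endpoints of intervals written as fractions of an integer and a positive integer), decides whether $\Pi$ and $\mathcal{D}$ have a stable model. -/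

import Mathlib

/-!
Propositional DatalogMTL with negation under the stable model semantics, over the rational timeline.
The relational atoms are the elements of a type `P` of propositions (predicates of arity zero), so
that there are no variables: every rule is ground and safe.
-/

namespace DatalogMTL

/-- An endpoint of an interval with its bracket: a rational endpoint that is included, a rational
endpoint that is excluded, or an infinite endpoint (`-∞` on the left, `∞` on the right). -/
inductive Endpoint where
  | incl (q : ℚ)
  | excl (q : ℚ)
  | infinite

/-- The time point `t` respects the left endpoint. -/
def Endpoint.LeftOf : Endpoint → ℚ → Prop
  | .incl q, t => q ≤ t
  | .excl q, t => q < t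
  | .infinite, _ => True

/-- The time point `t` respects the right endpoint. -/
def Endpoint.RightOf : Endpoint → ℚ → Prop
  | .incl q, t => t ≤ q
  | .excl q, t => t < q
  | .infinite, _ => True

/-- A (possibly empty) interval of rational time points, given by its two endpoints. -/
structure Interval where
  left : Endpoint
  right : Endpoint

/-- The set of time points of an interval. -/
def Interval.points (ρ : Interval) : Set ℚ := {t | ρ.left.LeftOf t ∧ ρ.right.RightOf t}

/-- Both endpoints are rational numbers. -/
def Interval.Bounded (ρ : Interval) : Prop := ρ.left ≠ .infinite ∧ ρ.right ≠ .infinite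

/-- The non-empty, non-negative intervals, which are the indices of the metric operators. -/
structure MetricInterval where
  interval : Interval
  nonempty : interval.points.Nonempty
  nonneg : ∀ t ∈ interval.points, 0 ≤ t

/-- The time points of the interval. -/
def MetricInterval.points (ρ : MetricInterval) : Set ℚ := ρ.interval.points

/-- Metric atoms. `diaM`, `boxM`, `since` look into the past, `diaP`, `boxP`, `until` into the
future. -/
inductive MetricAtom (P : Type) where
  | top
  | bot
  | prop (p : P)
  | diaM (ρ : MetricInterval) (M : MetricAtom P)
  | diaP (ρ : MetricInterval) (M : MetricAtom P)
  | boxM (ρ : MetricInterval) (M : MetricAtom P)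
  | boxP (ρ : MetricInterval) (M : MetricAtom P)
  | since (M₁ : MetricAtom P) (ρ : MetricInterval) (M₂ : MetricAtom P)
  | until (M₁ : MetricAtom P) (ρ : MetricInterval) (M₂ : MetricAtom P)

/-- An interpretation assigns to each time point the set of the propositions that hold there.
The pointwise order `≤` is containment of interpretations. -/
abbrev Interpretation (P : Type) := ℚ → Set P

/-- Satisfaction of a metric atom in an interpretation at a time point. -/
def Sat {P : Type} (I : Interpretation P) : ℚ → MetricAtom P → Prop
  | _, .top => True
  | _, .bot => False
  | t, .prop p => p ∈ I t
  | t, .diaM ρ M => ∃ t', t - t' ∈ ρ.points ∧ Sat I t' M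
  | t, .diaP ρ M => ∃ t', t' - t ∈ ρ.points ∧ Sat I t' M
  | t, .boxM ρ M => ∀ t', t - t' ∈ ρ.points → Sat I t' M
  | t, .boxP ρ M => ∀ t', t' - t ∈ ρ.points → Sat I t' M
  | t, .since M₁ ρ M₂ =>
      ∃ t', t - t' ∈ ρ.points ∧ Sat I t' M₂ ∧ ∀ t'', t' < t'' → t'' < t → Sat I t'' M₁
  | t, .until M₁ ρ M₂ =>
      ∃ t', t' - t ∈ ρ.points ∧ Sat I t' M₂ ∧ ∀ t'', t < t'' → t'' < t' → Sat I t'' M₁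

/-- The metric atoms that are allowed as rule heads: those built from `⊤`, `⊥` and propositions
with the two box operators. -/
def MetricAtom.IsHead {P : Type} : MetricAtom P → Prop
  | .top => True
  | .bot => True
  | .prop _ => True
  | .boxM _ M => M.IsHead
  | .boxP _ M => M.IsHead
  | .diaM _ _ => False
  | .diaP _ _ => False
  | .since _ _ _ => False
  | .until _ _ _ => False

/-- The metric atom does not mention the future operators diamond-plus, box-plus and until. -/
def MetricAtom.NoFuture {P : Type} : MetricAtom P → Prop
  | .top => True
  | .bot => True
  | .prop _ => True
  | .diaM _ M => M.NoFuture
  | .boxM _ M => M.NoFuture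
  | .since M₁ _ M₂ => M₁.NoFuture ∧ M₂.NoFuture
  | .diaP _ _ => False
  | .boxP _ _ => False
  | .until _ _ _ => False

/-- The metric atom does not mention the operator box-minus. -/
def MetricAtom.NoBoxMinus {P : Type} : MetricAtom P → Prop
  | .top => True
  | .bot => True
  | .prop _ => True
  | .boxM _ _ => False
  | .boxP _ M => M.NoBoxMinus
  | .diaM _ M => M.NoBoxMinus
  | .diaP _ M => M.NoBoxMinus
  | .since M₁ _ M₂ => M₁.NoBoxMinus ∧ M₂.NoBoxMinus
  | .until M₁ _ M₂ => M₁.NoBoxMinus ∧ M₂.NoBoxMinus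

/-- A rule `head ← ⋀ pos ∧ ⋀ not neg`. -/
structure Rule (P : Type) where
  head : MetricAtom P
  pos : List (MetricAtom P)
  neg : List (MetricAtom P)
  isHead : head.IsHead

/-- A (propositional) program is a finite set of rules. -/
abbrev Program (P : Type) := Finset (Rule P)

/-- A program is forward-propagating if its rule bodies do not mention the future operators, and its
rule heads do not mention box-minus. -/
def Program.ForwardPropagating {P : Type} (Pi : Program P) : Prop :=
  ∀ r ∈ Pi, r.head.NoBoxMinus ∧ (∀ M ∈ r.pos, M.NoFuture) ∧ (∀ M ∈ r.neg, M.NoFuture)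

/-- A (propositional) dataset is a finite set of facts `p @ ρ` with `ρ` a non-empty interval. -/
structure Dataset (P : Type) where
  facts : Finset (P × Interval)
  nonempty : ∀ F ∈ facts, F.2.points.Nonempty

/-- All intervals that the dataset mentions are bounded. -/
def Dataset.Bounded {P : Type} (D : Dataset P) : Prop := ∀ F ∈ D.facts, F.2.Bounded

/-- The interpretation is a model of the dataset. -/
def Dataset.Model {P : Type} (D : Dataset P) (I : Interpretation P) : Prop :=
  ∀ F ∈ D.facts, ∀ t ∈ F.2.points, F.1 ∈ I t

/-- With `J` evaluating the positive body atoms and the head, and `T` evaluating the negated body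
atoms, the rule holds at every time point. -/
def Rule.Holds {P : Type} (r : Rule P) (J T : Interpretation P) : Prop :=
  ∀ t, (∀ M ∈ r.pos, Sat J t M) → (∀ M ∈ r.neg, ¬ Sat T t M) → Sat J t r.head

/-- `(H, T)` is an HT-interpretation that is an HT-model of the program and of the dataset. -/
def HTModel {P : Type} (Pi : Program P) (D : Dataset P) (H T : Interpretation P) : Prop :=
  H ≤ T ∧ D.Model H ∧ ∀ r ∈ Pi, r.Holds H T ∧ r.Holds T T

/-- `T` is a stable model: `(T, T)` is an HT-model, and `T` is the least among the
interpretations `H` such that `(H, T)` is an HT-model. -/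
def StableModel {P : Type} (Pi : Program P) (D : Dataset P) (T : Interpretation P) : Prop :=
  HTModel Pi D T T ∧ IsLeast {H | HTModel Pi D H T} T

/-- The program and the dataset have a stable model. -/
def HasStableModel {P : Type} (Pi : Program P) (D : Dataset P) : Prop :=
  ∃ T, StableModel Pi D T

/-- Fractions with an integer numerator and a positive integer denominator, not necessarily in
lowest terms. -/
abbrev Fraction := ℤ × ℕ+

/-- The rational number that a fraction denotes. -/
def Fraction.value (x : Fraction) : ℚ := (x.1 : ℚ) / ((x.2 : ℕ) : ℚ)

/-- Finite representation of an endpoint: `none` for an infinite endpoint, otherwise a bracket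
(`true` if the endpoint is included) and a fraction. -/
abbrev EndpointCode := Option (Bool × Fraction)

/-- The endpoint that is represented. -/
def EndpointCode.decode : EndpointCode → Endpoint
  | none => .infinite
  | some (true, x) => .incl (Fraction.value x)
  | some (false, x) => .excl (Fraction.value x)

/-- Finite representation of a fact: a proposition (the propositions are numbered) and the left and
right endpoints of an interval. -/
abbrev FactCode := ℕ × EndpointCode × EndpointCode

/-- The proposition and the interval that are represented. -/
def FactCode.decode (c : FactCode) : ℕ × Interval :=
  (c.1, ⟨EndpointCode.decode c.2.1, EndpointCode.decode c.2.2⟩)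

/-- The list of codes, which is what an algorithm gets as its input, represents the dataset:
it lists its facts, in any order and possibly with repetitions. -/
def Represents (cs : List FactCode) (D : Dataset ℕ) : Prop :=
  ∀ F, F ∈ D.facts ↔ F ∈ cs.map FactCode.decode

/-- The data complexity version of reasoning with the fixed program `Pi` over bounded datasets is
decidable: there is an algorithm (a partial recursive function) that halts on each representation of
a bounded dataset, and tells whether the program and the dataset have a stable model. -/
def DecidableOnBoundedData (Pi : Program ℕ) : Prop :=
  ∃ f : List FactCode →. Bool, Partrec f ∧
    ∀ D : Dataset ℕ, D.Bounded → ∀ cs, Represents cs D →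
      ∃ b, b ∈ f cs ∧ (b = true ↔ HasStableModel Pi D)

end DatalogMTL

/-! The run of a Turing machine is laid out on ℚ. Row `n` of its space-time diagram occupies `(n, n
+ 1]`, with cell `i` at `n + 1 / (i + 1)`: density leaves room for infinitely many cells in a unit
of time. Cells are listed backwards in time, so a cell reaches the next one of its row by "since"
over cell-free time, and its own earlier state by a diamond over `[1, 1]`. Past operators suffice.

The rules `p ← not p'` and `p' ← not p` guess a valuation, and constraints with head `⊥` check it;
by `hasStableModel_guessAndCheck_iff`, stable models amount to the valuations that pass. A
constraint may thus prescribe values at earlier times, although the program is forward-propagating.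

To make the update local, the tape moves instead of the head: the head stays at cell `0`, whose
operation is broadcast along the row. One constraint forbids the halting operations. If the machine
never halts, the intended diagram passes (`isGrid_runValuation`); conversely every valuation that
passes contains the whole run (`IsGrid.op_not_mem`). So a stable model exists iff the machine runs
forever. The program depends on the machine only; the input is placed in the dataset. -/

open Turing

/-! ### Undecidable halting on a unary family of inputs -/

/-- Termination of a Post-Turing machine on the unary family of inputs `γ₀ γ₁ γ₂ … γ₂` is
undecidable for a suitable machine with finitely many symbols and reachable states. -/
theorem exists_tm0_not_computablePred :
    ∃ (Γ Λ : Type) (_ : Inhabited Γ) (_ : Finite Γ) (_ : Inhabited Λ) (M : TM0.Machine Γ Λ)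
      (S : Finset Λ) (γ₀ γ₁ γ₂ : Γ), TM0.Supports M (S : Set Λ) ∧
      ¬ ComputablePred fun x : ℕ => (TM0.eval M (γ₀ :: γ₁ :: List.replicate x γ₂)).Dom := by
  -- Numbers are written in binary, least significant digit first, so `2 ^ x` becomes `x` zeros and
  -- a one. Restricting to powers of two yields tapes of the required shape; `φ` recovers the
  -- exponent and runs it as a code.
  obtain ⟨φ, hφ, hφ'⟩ : ∃ φ : ℕ →. ℕ, Partrec φ ∧
      ¬ ComputablePred fun x : ℕ => (φ (2 ^ x)).Dom := by
    have hpow : Primrec₂ ((· ^ ·) : ℕ → ℕ → ℕ) := Primrec₂.unpaired'.1 Nat.Primrec.pow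
    have hlog : Primrec fun y : ℕ => Nat.findGreatest (fun k => 2 ^ k ≤ y) y :=
      Primrec.nat_findGreatest Primrec.id
        (Primrec.nat_le.comp (hpow.comp (Primrec.const 2) Primrec.snd) Primrec.fst)
    have hx (x : ℕ) : Nat.findGreatest (fun k => 2 ^ k ≤ 2 ^ x) (2 ^ x) = x := by
      rw [Nat.findGreatest_eq_iff]
      exact ⟨Nat.lt_two_pow_self.le, fun _ => le_rfl,
        fun n hn _ => not_le.2 (Nat.pow_lt_pow_right (by norm_num) hn)⟩
    refine ⟨fun y => Nat.Partrec.Code.eval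
      (Denumerable.ofNat Nat.Partrec.Code (Nat.findGreatest (fun k => 2 ^ k ≤ y) y)) 0,
      Nat.Partrec.Code.eval_part.comp ((Primrec.ofNat _).comp hlog).to_comp (Computable.const 0),
      fun h => ?_⟩
    apply ComputablePred.halting_problem 0
    refine ComputablePred.computable_of_manyOneReducible
      ⟨Encodable.encode, Computable.encode, fun c => ?_⟩ h
    simp only [hx, Denumerable.ofNat_encode]
  obtain ⟨c, hc⟩ := ToPartrec.Code.exists_code (Nat.Partrec'.part_iff₁.2 hφ)
  let iΛ : Inhabited PartrecToTM2.Λ' := ⟨PartrecToTM2.trNormal c PartrecToTM2.Cont'.halt⟩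
  let M₁ := TM2to1.tr PartrecToTM2.tr
  let iΛ' : Inhabited (TM1to0.Λ' M₁) := inferInstance
  have hS := TM1to0.tr_supports M₁ (TM2to1.tr_supports _ (PartrecToTM2.tr_supports c .halt))
  let up (b : Bool) (a : PartrecToTM2.Γ') :
      TM2to1.Γ' PartrecToTM2.K' (fun _ => PartrecToTM2.Γ') :=
    (b, Function.update (fun _ => none) PartrecToTM2.K'.main (some a))
  let iK : Fintype PartrecToTM2.K' :=
    ⟨{.main, .rev, .aux, .stack}, fun k => by cases k <;> simp⟩
  refine ⟨_, _, inferInstance, Fintype.finite (TM2to1.Γ'.fintype), iΛ', TM1to0.tr M₁, _,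
    up true .cons, up false .bit1, (up false .bit0), hS, ?_⟩
  refine fun h => hφ' (h.of_eq fun x => ?_)
  have hnum (x : ℕ) : PartrecToTM2.trNat (2 ^ x) = List.replicate x .bit0 ++ [.bit1] := by
    have h (x : ℕ) : ∃ p : PosNum, ((2 ^ x : ℕ) : Num) = .pos p ∧
        PartrecToTM2.trPosNum p = List.replicate x .bit0 ++ [.bit1] := by
      induction x with
      | zero => exact ⟨1, rfl, rfl⟩
      | succ x ih =>
        obtain ⟨p, hp, hp'⟩ := ih
        refine ⟨p.bit0, ?_, ?_⟩
        · rw [pow_succ, mul_two, Nat.cast_add, hp]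
          exact (Num.bit0_of_bit0 (.pos p))
        · rw [PartrecToTM2.trPosNum, hp']; rfl
    obtain ⟨p, hp, hp'⟩ := h x
    rw [PartrecToTM2.trNat, hp]; exact hp'
  have hinit : up true .cons :: up false .bit1 :: List.replicate x (up false .bit0)
      = TM2to1.trInit PartrecToTM2.K'.main (PartrecToTM2.trList [2 ^ x]) := by
    have hrev : (PartrecToTM2.trList [2 ^ x]).reverse =
        .cons :: .bit1 :: List.replicate x .bit0 := by
      simp [hnum]
    unfold TM2to1.trInit
    rw [hrev]
    exact congrArg (fun l => up true .cons :: up false .bit1 :: l) List.map_replicate.symm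
  rw [hinit]
  refine ((iff_of_eq (congrArg Part.Dom (TM1to0.tr_eval M₁ _))).trans
    (TM2to1.tr_eval_dom PartrecToTM2.tr _ _)).trans ?_
  have h2 : TM2.init PartrecToTM2.K'.main (PartrecToTM2.trList [2 ^ x])
      = PartrecToTM2.init c [2 ^ x] := by
    unfold TM2.init PartrecToTM2.init
    congr 1
    funext k; cases k <;> rfl
  have h3 := PartrecToTM2.tr_eval c [2 ^ x]
  have h4 := hc (2 ^ x ::ᵥ List.Vector.nil)
  rw [show (2 ^ x ::ᵥ List.Vector.nil).1 = [2 ^ x] from rfl] at h4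
  change (StateTransition.eval (TM2.step PartrecToTM2.tr)
    (TM2.init PartrecToTM2.K'.main (PartrecToTM2.trList [2 ^ x]))).Dom ↔ _
  rw [h2, h3, h4]
  rfl

/-! ### Turing machines as broadcast automata -/

/-- A cellular automaton on the half line `ℕ` in which cell `0` additionally broadcasts, at every
step, an operation `op a` determined by its own state `a` to all the cells. -/
structure BroadcastAutomaton (A B : Type) where
  op : A → B
  edge : B → A → A → A
  inner : B → A → A → A → A

/-- The state of cell `i` after `n` steps from the initial row `u`. -/
def BroadcastAutomaton.row {A B : Type} (C : BroadcastAutomaton A B) (u : ℕ → A) : ℕ → ℕ → A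
  | 0, i => u i
  | n + 1, 0 => C.edge (C.op (C.row u n 0)) (C.row u n 0) (C.row u n 1)
  | n + 1, i + 1 =>
    C.inner (C.op (C.row u n 0)) (C.row u n i) (C.row u n (i + 1)) (C.row u n (i + 2))

/-- The row `a₀ a₁ a₂ … a₂ a₃ a₃ …` with `x` occurrences of `a₂`. -/
def inputRow {A : Type} (a₀ a₁ a₂ a₃ : A) (x i : ℕ) : A :=
  if i = 0 then a₀ else if i = 1 then a₁ else if i < x + 2 then a₂ else a₃

/-- Letting halted configurations stay fixed makes the step total, which matches an automaton that
freezes once its machine halts. -/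
theorem StateTransition.eval_dom_iff_iterate {σ : Type*} (f : σ → Option σ) (a : σ) :
    (StateTransition.eval f a).Dom ↔ ∃ n, f ((fun b => (f b).getD b)^[n] a) = none := by
  constructor
  · intro h
    obtain ⟨hr, hn⟩ := StateTransition.mem_eval.1 (Part.get_mem h)
    suffices ∃ n, (fun b => (f b).getD b)^[n] a = (StateTransition.eval f a).get h by
      obtain ⟨n, hn'⟩ := this
      exact ⟨n, hn' ▸ hn⟩
    clear hn
    generalize (StateTransition.eval f a).get h = b at hr
    induction hr with
    | refl => exact ⟨0, rfl⟩
    | @tail b c _ hbc ih =>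
      obtain ⟨n, hn⟩ := ih
      refine ⟨n + 1, ?_⟩
      rw [Function.iterate_succ_apply', hn, Option.mem_def.1 hbc, Option.getD_some]
  · rintro ⟨n, hn⟩
    suffices StateTransition.Reaches f a ((fun b => (f b).getD b)^[n] a) from
      (StateTransition.mem_eval.2 ⟨this, hn⟩).1
    clear hn
    induction n with
    | zero => exact .refl
    | succ n ih =>
      rw [Function.iterate_succ_apply']
      generalize (fun b => (f b).getD b)^[n] a = b at ih
      cases hb : f b with
      | none => exact ih
      | some c => exact ih.tail hb

/-- The automaton that simulates a Post-Turing machine with the head kept at cell `0`. Cell `i`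
stores the state of the machine and the two tape symbols at distance `i` from the head. -/
def tapeAutomaton {Γ Λ S : Type} [Inhabited Λ] (M : TM0.Machine Γ Λ) (r : Λ → S) (s : S → Λ) :
    BroadcastAutomaton (S × Γ × Γ) (S × Γ) where
  op a := (a.1, a.2.1)
  edge b x y := match M (s b.1) b.2 with
    | none => x
    -- Cell `0` holds the scanned symbol on both tracks, so a move fills both from the same
    -- neighbouring symbol.
    | some (q, .move .right) => (r q, y.2.1, y.2.1)
    | some (q, .move .left) => (r q, y.2.2, y.2.2)
    | some (q, .write c) => (r q, c, c)
  inner b w x y := match M (s b.1) b.2 with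
    | none => x
    -- A right move brings the right half of the tape one cell closer and pushes the left half one
    -- cell away.
    | some (q, .move .right) => (r q, y.2.1, w.2.2)
    | some (q, .move .left) => (r q, w.2.1, y.2.2)
    | some (q, .write _) => (r q, x.2.1, x.2.2)

/-- Machine and automaton proceed in lockstep. Membership of the state in `Q` is carried along the
induction because `s` inverts `r` only there. -/
theorem tapeAutomaton_row {Γ Λ S : Type} [Inhabited Λ] [Inhabited Γ] (M : TM0.Machine Γ Λ)
    (r : Λ → S) (s : S → Λ) (Q : Set Λ) (hM : TM0.Supports M Q) (hr : ∀ q ∈ Q, s (r q) = q)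
    (c : TM0.Cfg Γ Λ) (hc : c.q ∈ Q) (n : ℕ) :
    ((fun c => (TM0.step M c).getD c)^[n] c).q ∈ Q ∧
    ∀ i : ℕ, (tapeAutomaton M r s).row (fun i => (r c.q, c.Tape.nth i, c.Tape.nth (-i))) n i =
      (r ((fun c => (TM0.step M c).getD c)^[n] c).q,
        ((fun c => (TM0.step M c).getD c)^[n] c).Tape.nth i,
        ((fun c => (TM0.step M c).getD c)^[n] c).Tape.nth (-i)) := by
  induction n with
  | zero => exact ⟨hc, fun i => rfl⟩
  | succ n ih =>
    rw [Function.iterate_succ_apply']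
    generalize (fun c => (TM0.step M c).getD c)^[n] c = d at ih
    obtain ⟨q, T⟩ := d
    obtain ⟨hq, hrow⟩ := ih
    have hop : (tapeAutomaton M r s).op
        ((tapeAutomaton M r s).row (fun i => (r c.q, c.Tape.nth i, c.Tape.nth (-i))) n 0) =
        (r q, T.1) := by rw [hrow]; rfl
    cases hs : M q T.1 with
    | none =>
      have hstep : TM0.step M ⟨q, T⟩ = none := by simp [TM0.step, hs]
      rw [hstep, Option.getD_none]
      refine ⟨hq, fun i => ?_⟩
      cases i with
      | zero => rw [BroadcastAutomaton.row, hop, hrow]; simp [tapeAutomaton, hr q hq, hs]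
      | succ i => rw [BroadcastAutomaton.row, hop, hrow (i + 1)]; simp [tapeAutomaton, hr q hq, hs]
    | some p =>
      obtain ⟨q', a⟩ := p
      cases hstep : TM0.step M ⟨q, T⟩ with
      | none => simp [TM0.step, hs] at hstep
      | some d =>
        refine ⟨TM0.step_supports M hM hstep hq, fun i => ?_⟩
        rw [Option.getD_some]
        simp only [TM0.step, hs, Option.map_some, Option.some.injEq] at hstep
        subst hstep
        cases i with
        | zero =>
          rw [BroadcastAutomaton.row, hop, hrow, hrow]
          rcases a with (_ | _) | a <;>
            simp [tapeAutomaton, hr q hq, hs, -Tape.nth_zero]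
        | succ i =>
          rw [BroadcastAutomaton.row, hop, hrow, hrow, hrow]
          have h1 : (-(i + 1 : ℤ) + 1) = -i := by ring
          have h2 : (-(i + 1 : ℤ) - 1) = -(i + 2) := by ring
          have h3 : ((i : ℤ) + 1 + 1) = i + 2 := by ring
          have h4 : ¬ ((i : ℤ) + 1 = 0) := by omega
          have h5 : ¬ (-(i + 1 : ℤ) = 0) := by omega
          rcases a with (_ | _) | a <;>
            simp only [tapeAutomaton, hr q hq, hs, Nat.cast_add, Nat.cast_one, Nat.cast_ofNat,
              Tape.move_left_nth, Tape.move_right_nth, Tape.write_nth, h1, h2, h3, h4, h5,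
              add_sub_cancel_right, if_false]

theorem Turing.Tape.mk₁_nth_natCast {Γ : Type*} [Inhabited Γ] (l : List Γ) (i : ℕ) :
    (Tape.mk₁ l).nth i = l.getI i := by
  rw [Tape.mk₁, Tape.mk₂, Tape.mk'_nth_nat, ListBlank.nth_mk]

theorem Turing.Tape.mk₁_nth_neg {Γ : Type*} [Inhabited Γ] (l : List Γ) (i : ℕ) :
    (Tape.mk₁ l).nth (-(i + 1 : ℕ)) = default := by
  change (ListBlank.mk []).nth i = default
  rw [ListBlank.nth_mk, List.getI_nil]

/-- The reachable states form a finite set, so finitely many cell values suffice. Halting shows in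
the broadcast pair of state and scanned symbol: it is one on which `M` is undefined. -/
theorem exists_broadcastAutomaton_not_computablePred :
    ∃ (A B : Type) (_ : Finite A) (_ : Finite B) (C : BroadcastAutomaton A B) (H : Set B)
      (a₀ a₁ a₂ a₃ : A),
      ¬ ComputablePred fun x : ℕ => ∃ n, C.op (C.row (inputRow a₀ a₁ a₂ a₃ x) n 0) ∈ H := by
  classical
  obtain ⟨Γ, Λ, _, _, _, M, S, γ₀, γ₁, γ₂, hS, hM⟩ := exists_tm0_not_computablePred
  let r (q : Λ) : S := if h : q ∈ S then ⟨q, h⟩ else ⟨default, hS.1⟩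
  have hr (q : Λ) (hq : q ∈ (S : Set Λ)) : (r q : Λ) = q := by
    simp [r, Finset.mem_coe.1 hq]
  let d : S := r default
  refine ⟨S × Γ × Γ, S × Γ, inferInstance, inferInstance, tapeAutomaton M r Subtype.val,
    {b | M b.1 b.2 = none}, (d, γ₀, γ₀), (d, γ₁, default), (d, γ₂, default), (d, default, default),
    fun h => hM (h.of_eq fun x => ?_)⟩
  have hrow : inputRow (d, γ₀, γ₀) (d, γ₁, default) (d, γ₂, default) (d, default, default) x =
      fun i : ℕ => (d, (Tape.mk₁ (γ₀ :: γ₁ :: List.replicate x γ₂)).nth i,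
        (Tape.mk₁ (γ₀ :: γ₁ :: List.replicate x γ₂)).nth (-i)) := by
    funext i
    match i with
    | 0 => rfl
    | 1 => rfl
    | i + 2 =>
      have hl : (γ₀ :: γ₁ :: List.replicate x γ₂).getI (i + 2) = if i < x then γ₂ else default := by
        simp only [List.getI_cons_succ]
        split_ifs with hi
        · rw [List.getI_eq_getElem _ (by simpa using hi)]; simp
        · exact List.getI_eq_default _ (by simpa using hi)
      rw [Tape.mk₁_nth_natCast, show i + 2 = (i + 1) + 1 from rfl, Tape.mk₁_nth_neg, hl]
      simp only [inputRow, Nat.add_lt_add_iff_right, if_false, show ¬ i + 2 = 0 by omega,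
        show ¬ i + 2 = 1 by omega]
      split_ifs <;> rfl
  have key (n : ℕ) := tapeAutomaton_row M r Subtype.val S hS hr
    (TM0.init (γ₀ :: γ₁ :: List.replicate x γ₂)) hS.1 n
  change _ ↔ (StateTransition.eval _ _).Dom
  rw [StateTransition.eval_dom_iff_iterate, hrow]
  refine exists_congr fun n => ?_
  rw [show d = r (TM0.init (Λ := Λ) (γ₀ :: γ₁ :: List.replicate x γ₂)).q from rfl]
  erw [(key n).2 0]
  have hq := (key n).1
  generalize (fun c => (TM0.step M c).getD c)^[n]
    (TM0.init (γ₀ :: γ₁ :: List.replicate x γ₂)) = c at *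
  obtain ⟨q, T⟩ := c
  simp [tapeAutomaton, hr q hq, TM0.step]

/-! ### Stable models of guess-and-check programs -/

namespace DatalogMTL

theorem Sat.mono {P : Type} {I J : Interpretation P} (h : I ≤ J) (M : MetricAtom P) :
    ∀ t, Sat I t M → Sat J t M := by
  induction M with
  | top => exact fun _ => id
  | bot => exact fun _ => id
  | prop p => exact fun t hp => h t hp
  | diaM ρ M ih => exact fun t ⟨t', ht, hM⟩ => ⟨t', ht, ih t' hM⟩
  | diaP ρ M ih => exact fun t ⟨t', ht, hM⟩ => ⟨t', ht, ih t' hM⟩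
  | boxM ρ M ih => exact fun t hM t' ht => ih t' (hM t' ht)
  | boxP ρ M ih => exact fun t hM t' ht => ih t' (hM t' ht)
  | since M₁ ρ M₂ ih₁ ih₂ =>
    exact fun t ⟨t', ht, hM, hM'⟩ => ⟨t', ht, ih₂ t' hM, fun s h₁ h₂ => ih₁ s (hM' s h₁ h₂)⟩
  | _ M₁ ρ M₂ ih₁ ih₂ =>
    exact fun t ⟨t', ht, hM, hM'⟩ => ⟨t', ht, ih₂ t' hM, fun s h₁ h₂ => ih₁ s (hM' s h₁ h₂)⟩

/-- The integrity constraint `⊥ ← ⋀ pos ∧ ⋀ not neg`, given by the pair `(pos, neg)`. -/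
def constraintRule {P : Type} (c : List (MetricAtom P) × List (MetricAtom P)) : Rule P :=
  ⟨.bot, c.1, c.2, trivial⟩

/-- The rule `p ← not p'`. -/
def choiceRule {P : Type} (p p' : P) : Rule P := ⟨.prop p, [], [.prop p'], trivial⟩

/-- The interpretation satisfies the integrity constraint at every time point. -/
def Respects {P : Type} (I : Interpretation P)
    (c : List (MetricAtom P) × List (MetricAtom P)) : Prop :=
  ∀ t, (∀ M ∈ c.1, Sat I t M) → ∃ M ∈ c.2, Sat I t M

/-- The interpretation in which `code (inl q)` holds where `q` does, and `code (inr q)` elsewhere. -/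
def literals {P Q : Type} (code : Q ⊕ Q → P) (V : ℚ → Set Q) : Interpretation P :=
  fun t => code '' {x | Sum.elim (· ∈ V t) (· ∉ V t) x}

section
variable {P Q : Type} {code : Q ⊕ Q → P}

theorem mem_literals_inl (hcode : code.Injective) (V : ℚ → Set Q) (t : ℚ) (q : Q) :
    code (.inl q) ∈ literals code V t ↔ q ∈ V t :=
  hcode.mem_set_image

theorem mem_literals_inr (hcode : code.Injective) (V : ℚ → Set Q) (t : ℚ) (q : Q) :
    code (.inr q) ∈ literals code V t ↔ q ∉ V t :=
  hcode.mem_set_image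

/-- The rules that choose freely, at every time point, one of the two literals of each `q`,
together with integrity constraints. -/
def guessAndCheck (code : Q ⊕ Q → P) (K : Set (List (MetricAtom P) × List (MetricAtom P))) :
    Set (Rule P) :=
  Set.range (fun q => choiceRule (code (.inl q)) (code (.inr q))) ∪
    Set.range (fun q => choiceRule (code (.inr q)) (code (.inl q))) ∪ constraintRule '' K

/-- A stable model contains at least one literal of each pair. Its positive literals, completed by
complements where they fail, already form an HT-model below it: choice rules consult only `T`,
constraints survive by monotonicity, and the facts are positive. Leastness then excludes points with
both literals. -/
theorem hasStableModel_guessAndCheck_iff (hcode : code.Injective)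
    {K : Set (List (MetricAtom P) × List (MetricAtom P))} {Pi : Program P}
    (hPi : (Pi : Set (Rule P)) = guessAndCheck code K) {D : Dataset P}
    (hD : ∀ F ∈ D.facts, ∃ q, F.1 = code (.inl q)) :
    HasStableModel Pi D ↔
      ∃ V, D.Model (literals code V) ∧ ∀ c ∈ K, Respects (literals code V) c := by
  have hmem (r : Rule P) : r ∈ Pi ↔ ((∃ q, choiceRule (code (.inl q)) (code (.inr q)) = r) ∨
      ∃ q, choiceRule (code (.inr q)) (code (.inl q)) = r) ∨ ∃ c ∈ K, constraintRule c = r := by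
    rw [← Finset.mem_coe, hPi]; rfl
  constructor
  · rintro ⟨T, ⟨-, hTD, hTr⟩, -, hleast⟩
    have hchoice (q : Q) (t : ℚ) : code (.inl q) ∉ T t → code (.inr q) ∈ T t := fun h =>
      (hTr _ ((hmem _).2 (.inl (.inr ⟨q, rfl⟩)))).2 t (by simp [choiceRule])
        (by simpa [choiceRule, Sat] using h)
    have hchoice' (q : Q) (t : ℚ) : code (.inr q) ∉ T t → code (.inl q) ∈ T t := fun h =>
      (hTr _ ((hmem _).2 (.inl (.inl ⟨q, rfl⟩)))).2 t (by simp [choiceRule])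
        (by simpa [choiceRule, Sat] using h)
    let V : ℚ → Set Q := fun t => {q | code (.inl q) ∈ T t}
    have hVT : literals code V ≤ T := by
      rintro t _ ⟨q | q, hq, rfl⟩
      · exact hq
      · exact hchoice q t hq
    have hVD : D.Model (literals code V) := by
      intro F hF t ht
      obtain ⟨q, hq⟩ := hD F hF
      rw [hq]
      refine (mem_literals_inl hcode V t q).2 ?_
      change code (.inl q) ∈ T t
      exact hq ▸ hTD F hF t ht
    have hTV : T = literals code V := by
      refine le_antisymm (hleast ⟨hVT, hVD, fun r hr => ⟨?_, (hTr r hr).2⟩⟩) hVT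
      rcases (hmem r).1 hr with (⟨q, rfl⟩ | ⟨q, rfl⟩) | ⟨c, hc, rfl⟩
      · intro t _ hn
        refine (mem_literals_inl hcode V t q).2 (hchoice' q t ?_)
        simpa [choiceRule, Sat] using hn
      · intro t _ hn
        refine (mem_literals_inr hcode V t q).2 ?_
        change code (.inl q) ∉ T t
        simpa [choiceRule, Sat] using hn
      · intro t hp hn
        exact (hTr _ hr).2 t (fun M hM => Sat.mono hVT M t (hp M hM)) hn
    refine ⟨V, hVD, fun c hc t hp => ?_⟩
    rw [← hTV] at hp ⊢
    by_contra hn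
    exact (hTr _ ((hmem _).2 (.inr ⟨c, hc, rfl⟩))).2 t hp (by simpa [constraintRule] using hn)
  · rintro ⟨V, hVD, hK⟩
    have hT : HTModel Pi D (literals code V) (literals code V) := by
      refine ⟨le_rfl, hVD, fun r hr => and_self_iff.2 ?_⟩
      rcases (hmem r).1 hr with (⟨q, rfl⟩ | ⟨q, rfl⟩) | ⟨c, hc, rfl⟩
      · intro t _ hn
        refine (mem_literals_inl hcode V t q).2 ?_
        simpa [choiceRule, Sat, mem_literals_inr hcode] using hn
      · intro t _ hn
        refine (mem_literals_inr hcode V t q).2 ?_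
        simpa [choiceRule, Sat, mem_literals_inl hcode] using hn
      · intro t hp hn
        obtain ⟨M, hM, hs⟩ := hK c hc t hp
        exact hn M hM hs
    -- Each true literal is derived in every competing `H` by its own choice rule, which has no
    -- positive body.
    refine ⟨_, hT, hT, fun H hH t => ?_⟩
    rintro _ ⟨q | q, hq, rfl⟩
    · exact (hH.2.2 _ ((hmem _).2 (.inl (.inl ⟨q, rfl⟩)))).1 t (by simp [choiceRule])
        (by simpa [choiceRule, Sat, mem_literals_inr hcode] using hq)
    · exact (hH.2.2 _ ((hmem _).2 (.inl (.inr ⟨q, rfl⟩)))).1 t (by simp [choiceRule])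
        (by simpa [choiceRule, Sat, mem_literals_inl hcode] using hq)

end

/-! ### Space-time diagrams as integrity constraints -/

/-- The interval `[1, 1]`. -/
def MetricInterval.one : MetricInterval where
  interval := ⟨.incl 1, .incl 1⟩
  nonempty := ⟨1, le_rfl, le_rfl⟩
  nonneg _ h := zero_le_one.trans h.1

/-- The interval `(a, ∞)`. -/
def MetricInterval.greater (a : ℚ) (ha : 0 ≤ a) : MetricInterval where
  interval := ⟨.excl a, .infinite⟩
  nonempty := ⟨a + 1, lt_add_one a, trivial⟩
  nonneg _ h := ha.trans h.1.le

theorem sat_diaM_one {P : Type} (I : Interpretation P) (t : ℚ) (M : MetricAtom P) :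
    Sat I t (.diaM .one M) ↔ Sat I (t - 1) M := by
  have h (t' : ℚ) : t - t' ∈ MetricInterval.one.points ↔ t' = t - 1 := by
    change (1 ≤ t - t' ∧ t - t' ≤ 1) ↔ _
    constructor
    · rintro ⟨h₁, h₂⟩; linarith
    · rintro rfl; constructor <;> linarith
  simp [Sat, h]

theorem mem_points_greater (a : ℚ) (ha : 0 ≤ a) (s : ℚ) :
    s ∈ (MetricInterval.greater a ha).points ↔ a < s :=
  iff_of_eq (and_true _)

/-- The propositions that describe the space-time diagram of a broadcast automaton. -/
inductive GridProp (A B : Type) where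
  /-- the time point `0` -/
  | start
  /-- the time points of the leftmost cell in the rows -/
  | edge
  /-- the time points that represent cells -/
  | cell
  /-- the time points that the dataset keeps free of cells -/
  | gap
  /-- the state of a cell -/
  | state (a : A)
  /-- the state that the dataset prescribes for the cells of the initial row -/
  | input (a : A)
  /-- the state of the next cell of the row -/
  | next (a : A)
  /-- the operation that is broadcast in the row -/
  | op (b : B)

instance {A B : Type} [Finite A] [Finite B] : Finite (GridProp A B) :=
  Finite.of_surjective (α := Fin 4 ⊕ (A ⊕ A) ⊕ (A ⊕ B))
    (Sum.elim ![.start, .edge, .cell, .gap]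
      (Sum.elim (Sum.elim .state .input) (Sum.elim .next .op))) (by
    rintro (_ | _ | _ | _ | a | a | a | b)
    exacts [⟨.inl 0, rfl⟩, ⟨.inl 1, rfl⟩, ⟨.inl 2, rfl⟩, ⟨.inl 3, rfl⟩, ⟨.inr (.inl (.inl a)), rfl⟩,
      ⟨.inr (.inl (.inr a)), rfl⟩, ⟨.inr (.inr (.inl a)), rfl⟩, ⟨.inr (.inr (.inr b)), rfl⟩])

section
variable {A B : Type}

/-- The last cell strictly before `t` is at a time point where `q` holds. -/
def AtPreviousCell (V : ℚ → Set (GridProp A B)) (q : GridProp A B) (t : ℚ) : Prop :=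
  ∃ t' < t, q ∈ V t' ∧ ∀ s, t' < s → s < t → .cell ∉ V s

/-- The valuation is consistent with a run of the automaton that avoids the operations in `H`.
The cells of a row are listed backwards in time, and rows are at distance `1`. -/
structure IsGrid (C : BroadcastAutomaton A B) (H : Set B) (V : ℚ → Set (GridProp A B)) : Prop where
  start_unique : ∀ t, .start ∈ V t → ∀ t' < t, .start ∉ V t'
  start_lt_cell : ∀ t, .cell ∈ V t → ∃ t' < t, .start ∈ V t'
  gap : ∀ t, .gap ∈ V t → .cell ∉ V t
  previous : ∀ t, .cell ∈ V t → AtPreviousCell V .cell t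
  cell_copy : ∀ t, .cell ∈ V (t - 1) → .cell ∈ V t
  -- With `start` at `0`, the condition exempts the initial row `(0, 1]`, which has no row before
  -- it.
  cell_origin : ∀ t, .cell ∈ V t → (∃ t' < t - 1, .start ∈ V t') → .cell ∈ V (t - 1)
  state_cell : ∀ t a, .state a ∈ V t → .cell ∈ V t
  op_cell : ∀ t b, .op b ∈ V t → .cell ∈ V t
  input : ∀ t a, .input a ∈ V t → .cell ∈ V t → .state a ∈ V t
  -- This relay makes the state two cells along the row available through a single "since".
  next : ∀ t a, .cell ∈ V t → AtPreviousCell V (.state a) t → .next a ∈ V t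
  edge_copy : ∀ t, .edge ∈ V (t - 1) → .edge ∈ V t
  edge_op : ∀ t a, .edge ∈ V t → .state a ∈ V t → .op (C.op a) ∈ V t
  op_copy : ∀ t b, .op b ∈ V t → AtPreviousCell V (.op b) t
  -- The neighbour on the edge side lies in the future of the updated cell, so the update is stated
  -- at that neighbour and prescribes the state of the previous cell.
  inner : ∀ t b a₁ a₂ a₃, .op b ∈ V (t - 1) → .state a₁ ∈ V (t - 1) →
    AtPreviousCell V (.state a₂) (t - 1) → AtPreviousCell V (.next a₃) (t - 1) →
    AtPreviousCell V (.state (C.inner b a₁ a₂ a₃)) t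
  edge_state : ∀ t b a₁ a₂, .edge ∈ V t → .op b ∈ V (t - 1) → .state a₁ ∈ V (t - 1) →
    AtPreviousCell V (.state a₂) (t - 1) → .state (C.edge b a₁ a₂) ∈ V t
  avoid : ∀ t, ∀ b ∈ H, .op b ∉ V t

variable {P : Type} (code : GridProp A B ⊕ GridProp A B → P)

/-- The metric atom for `q` itself. -/
def gridAtom (q : GridProp A B) : MetricAtom P := .prop (code (.inl q))

/-- The metric atom for `M` one time unit earlier. -/
def oneBefore (M : MetricAtom P) : MetricAtom P := .diaM .one M

/-- The metric atom for `AtPreviousCell`. -/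
def previousAtom (q : GridProp A B) : MetricAtom P :=
  -- Metric atoms have no negation; the complementary literal of `cell` stands in for it.
  .since (.prop (code (.inr .cell))) (.greater 0 le_rfl) (gridAtom code q)

/-- The integrity constraints that express `IsGrid`. -/
def gridConstraints (C : BroadcastAutomaton A B) (H : Set B) :
    Set (List (MetricAtom P) × List (MetricAtom P)) :=
  let L := gridAtom code
  let N := previousAtom code
  let W (M : MetricAtom P) : MetricAtom P := oneBefore M
  {([L .start, .diaM (.greater 0 le_rfl) (L .start)], []),
    ([L .cell], [.diaM (.greater 0 le_rfl) (L .start)]),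
    ([L .gap, L .cell], []),
    ([L .cell], [N .cell]),
    ([W (L .cell)], [L .cell]),
    ([L .cell, .diaM (.greater 1 zero_le_one) (L .start)], [W (L .cell)]),
    ([W (L .edge)], [L .edge])} ∪
  Set.range (fun a => ([L (.state a)], [L .cell])) ∪
  Set.range (fun b => ([L (.op b)], [L .cell])) ∪
  Set.range (fun a => ([L (.input a), L .cell], [L (.state a)])) ∪
  Set.range (fun a => ([L .cell, N (.state a)], [L (.next a)])) ∪
  Set.range (fun a => ([L .edge, L (.state a)], [L (.op (C.op a))])) ∪
  Set.range (fun b => ([L (.op b)], [N (.op b)])) ∪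
  Set.range (fun x : B × A × A × A =>
    ([W (L (.op x.1)), W (L (.state x.2.1)), W (N (.state x.2.2.1)), W (N (.next x.2.2.2))],
      [N (.state (C.inner x.1 x.2.1 x.2.2.1 x.2.2.2))])) ∪
  Set.range (fun x : B × A × A =>
    ([L .edge, W (L (.op x.1)), W (L (.state x.2.1)), W (N (.state x.2.2))],
      [L (.state (C.edge x.1 x.2.1 x.2.2))])) ∪
  (fun b => ([L (.op b)], [])) '' H

theorem finite_gridConstraints [Finite A] [Finite B] (C : BroadcastAutomaton A B) (H : Set B) :
    (gridConstraints code C H).Finite := by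
  unfold gridConstraints
  have := Set.toFinite H
  refine Set.Finite.union ?_ (this.image _)
  iterate 8 refine Set.Finite.union ?_ (Set.finite_range _)
  exact Set.toFinite _

variable {code}

theorem sat_gridAtom (hcode : code.Injective) (V : ℚ → Set (GridProp A B)) (t : ℚ)
    (q : GridProp A B) : Sat (literals code V) t (gridAtom code q) ↔ q ∈ V t :=
  mem_literals_inl hcode V t q

theorem sat_previousAtom (hcode : code.Injective) (V : ℚ → Set (GridProp A B)) (t : ℚ)
    (q : GridProp A B) : Sat (literals code V) t (previousAtom code q) ↔ AtPreviousCell V q t := by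
  simp [previousAtom, AtPreviousCell, Sat, gridAtom, mem_points_greater, mem_literals_inl hcode,
    mem_literals_inr hcode]

theorem respects_gridConstraints_iff (hcode : code.Injective) (C : BroadcastAutomaton A B)
    (H : Set B) (V : ℚ → Set (GridProp A B)) :
    (∀ c ∈ gridConstraints code C H, Respects (literals code V) c) ↔ IsGrid C H V := by
  have hdia (a : ℚ) (ha : 0 ≤ a) (t : ℚ) (q : GridProp A B) :
      Sat (literals code V) t (.diaM (.greater a ha) (gridAtom code q)) ↔
        ∃ t' < t - a, q ∈ V t' := by
    simp only [Sat, mem_points_greater, sat_gridAtom hcode, lt_sub_comm]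
  simp only [gridConstraints, Set.mem_union, Set.mem_insert_iff, Set.mem_singleton_iff,
    Set.mem_range, Set.mem_image, or_imp, forall_and, forall_eq, forall_exists_index,
    forall_apply_eq_imp_iff, forall_apply_eq_imp_iff₂, Respects, List.mem_cons, List.not_mem_nil,
    or_false, and_imp, exists_eq_left, false_and, exists_false, sat_gridAtom hcode, sat_previousAtom hcode, oneBefore,
    sat_diaM_one, hdia, sub_zero]
  constructor
  · rintro ⟨⟨⟨⟨⟨⟨⟨⟨⟨⟨h₁, h₂, h₃, h₄, h₅, h₆, h₇⟩, h₈⟩, h₉⟩, h₁₀⟩, h₁₁⟩, h₁₂⟩, h₁₃⟩, h₁₄⟩, h₁₅⟩, h₁₆⟩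
    exact ⟨h₁, h₂, h₃, h₄, h₅, fun t h ⟨t', ht, hs⟩ => h₆ t h t' ht hs, fun t a => h₈ a t,
      fun t b => h₉ b t, fun t a => h₁₀ a t, fun t a => h₁₁ a t, h₇, fun t a => h₁₂ a t,
      fun t b => h₁₃ b t, fun t b a₁ a₂ a₃ => h₁₄ (b, a₁, a₂, a₃) t,
      fun t b a₁ a₂ => h₁₅ (b, a₁, a₂) t, fun t b hb => h₁₆ b hb t⟩
  · rintro ⟨h₁, h₂, h₃, h₄, h₅, h₆, h₈, h₉, h₁₀, h₁₁, h₇, h₁₂, h₁₃, h₁₄, h₁₅, h₁₆⟩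
    exact ⟨⟨⟨⟨⟨⟨⟨⟨⟨⟨h₁, h₂, h₃, h₄, h₅, fun t h t' ht hs => h₆ t h ⟨t', ht, hs⟩, h₇⟩,
      fun a t => h₈ t a⟩, fun b t => h₉ t b⟩, fun a t => h₁₀ t a⟩, fun a t => h₁₁ t a⟩,
      fun a t => h₁₂ t a⟩, fun b t => h₁₃ t b⟩, fun x t => h₁₄ t x.1 x.2.1 x.2.2.1 x.2.2.2⟩,
      fun x t => h₁₅ t x.1 x.2.1 x.2.2⟩, fun b hb t => h₁₆ t b hb⟩

end

/-! ### Correctness of the encoding -/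

section
variable {A B : Type}

/-- The valuation agrees with the dataset for the initial row `inputRow a₀ a₁ a₂ a₃ x`. -/
structure MatchesInput (a₀ a₁ a₂ a₃ : A) (x : ℕ) (V : ℚ → Set (GridProp A B)) : Prop where
  start : .start ∈ V 0
  edge : .edge ∈ V 1
  cell : ∀ i < x + 3, .cell ∈ V (1 / ((i : ℚ) + 1))
  gap : ∀ i < x + 2, ∀ t : ℚ, 1 / ((i : ℚ) + 2) < t → t < 1 / ((i : ℚ) + 1) → .gap ∈ V t
  input₀ : .input a₀ ∈ V 1
  input₁ : .input a₁ ∈ V (1 / 2)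
  input₂ : ∀ t : ℚ, 1 / ((x : ℚ) + 3) < t → t < 1 / 2 → .input a₂ ∈ V t
  input₃ : ∀ t : ℚ, 0 < t → t ≤ 1 / ((x : ℚ) + 3) → .input a₃ ∈ V t

/-- The time point of cell `i` in row `n`. -/
def cellTime (n i : ℕ) : ℚ := n + 1 / ((i : ℚ) + 1)

theorem lt_cellTime (n i : ℕ) : (n : ℚ) < cellTime n i :=
  lt_add_of_pos_right _ (by positivity)

theorem cellTime_le (n i : ℕ) : cellTime n i ≤ n + 1 := by
  have : 1 / ((i : ℚ) + 1) ≤ 1 := by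
    rw [div_le_one (by positivity)]; linarith [i.cast_nonneg (α := ℚ)]
  exact add_le_add_right this _

theorem cellTime_succ (n i : ℕ) : cellTime (n + 1) i = cellTime n i + 1 := by
  simp only [cellTime, Nat.cast_add, Nat.cast_one]; ring

theorem cellTime_lt_iff (n i m j : ℕ) :
    cellTime n i < cellTime m j ↔ n < m ∨ n = m ∧ j < i := by
  rcases lt_trichotomy n m with h | rfl | h
  · have : (n : ℚ) + 1 ≤ m := by exact_mod_cast h
    have := (cellTime_le n i).trans_lt (this.trans_lt (lt_cellTime m j))
    simp [h, this]
  · simp only [cellTime, add_lt_add_iff_left, lt_irrefl, true_and, false_or]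
    rw [one_div_lt_one_div (by positivity) (by positivity), add_lt_add_iff_right, Nat.cast_lt]
  · have : (m : ℚ) + 1 ≤ n := by exact_mod_cast h
    have := (cellTime_le m j).trans_lt (this.trans_lt (lt_cellTime n i))
    simp [h.not_gt, h.ne', this.not_gt]

theorem cellTime_inj {n i m j : ℕ} (h : cellTime n i = cellTime m j) : n = m ∧ i = j := by
  have h₁ := (cellTime_lt_iff n i m j).not.1 h.not_lt
  have h₂ := (cellTime_lt_iff m j n i).not.1 h.not_gt
  omega

theorem cellTime_eq_add_one {t : ℚ} {n i : ℕ} (h : t - 1 = cellTime n i) :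
    t = cellTime (n + 1) i := by
  rw [cellTime_succ, ← h, sub_add_cancel]

/-- The valuation that describes the run of the automaton from the initial row `u`. -/
def runValuation (C : BroadcastAutomaton A B) (u : ℕ → A) (t : ℚ) : Set (GridProp A B) :=
  {q | match q with
    | .start => t = 0
    | .edge => ∃ n, t = cellTime n 0
    | .cell => ∃ n i, t = cellTime n i
    -- `gap` and `input` are taken as large as the constraints permit, so that dataset facts over
    -- whole intervals hold vacuously off the cells.
    | .gap => ¬ ∃ n i, t = cellTime n i
    | .state a => ∃ n i, t = cellTime n i ∧ C.row u n i = a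
    | .input a => ∀ n i, t = cellTime n i → C.row u n i = a
    | .next a => ∃ n i, t = cellTime n i ∧ C.row u n (i + 1) = a
    | .op b => ∃ n i, t = cellTime n i ∧ C.op (C.row u n 0) = b}

section
variable (C : BroadcastAutomaton A B) (u : ℕ → A)

theorem not_cell_runValuation {n i : ℕ} {t : ℚ} (h₁ : cellTime n (i + 1) < t)
    (h₂ : t < cellTime n i) : GridProp.cell ∉ runValuation C u t := by
  rintro ⟨m, j, rfl⟩
  rw [cellTime_lt_iff] at h₁ h₂
  omega

/-- Time strictly between consecutive cells is cell-free, and the next cell blocks any look further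
back. -/
theorem atPreviousCell_runValuation_iff {q : GridProp A B}
    (hq : ∀ t, q ∈ runValuation C u t → .cell ∈ runValuation C u t) (n i : ℕ) :
    AtPreviousCell (runValuation C u) q (cellTime n i) ↔
      q ∈ runValuation C u (cellTime n (i + 1)) := by
  have hlt : cellTime n (i + 1) < cellTime n i := by rw [cellTime_lt_iff]; omega
  constructor
  · rintro ⟨t', ht', hqt, hfree⟩
    rcases lt_trichotomy t' (cellTime n (i + 1)) with h | h | h
    · exact absurd ⟨n, i + 1, rfl⟩ (hfree _ h hlt)
    · exact h ▸ hqt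
    · exact absurd (hq _ hqt) (not_cell_runValuation C u h ht')
  · intro h
    exact ⟨_, hlt, h, fun s h₁ h₂ => not_cell_runValuation C u h₁ h₂⟩

theorem state_mem_runValuation {a : A} {n i : ℕ} :
    .state a ∈ runValuation C u (cellTime n i) ↔ C.row u n i = a := by
  constructor
  · rintro ⟨m, j, h, ha⟩
    obtain ⟨rfl, rfl⟩ := cellTime_inj h
    exact ha
  · exact fun h => ⟨n, i, rfl, h⟩

theorem next_mem_runValuation {a : A} {n i : ℕ} :
    .next a ∈ runValuation C u (cellTime n i) ↔ C.row u n (i + 1) = a := by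
  constructor
  · rintro ⟨m, j, h, ha⟩
    obtain ⟨rfl, rfl⟩ := cellTime_inj h
    exact ha
  · exact fun h => ⟨n, i, rfl, h⟩

theorem op_mem_runValuation {b : B} {n i : ℕ} :
    .op b ∈ runValuation C u (cellTime n i) ↔ C.op (C.row u n 0) = b := by
  constructor
  · rintro ⟨m, j, h, ha⟩
    obtain ⟨rfl, rfl⟩ := cellTime_inj h
    exact ha
  · exact fun h => ⟨n, i, rfl, h⟩

theorem isGrid_runValuation {H : Set B} (hH : ∀ n, C.op (C.row u n 0) ∉ H) :
    IsGrid C H (runValuation C u) := by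
  have hstate (a : A) (t : ℚ) : .state a ∈ runValuation C u t → .cell ∈ runValuation C u t :=
    fun ⟨n, i, h, _⟩ => ⟨n, i, h⟩
  have hnext (a : A) (t : ℚ) : .next a ∈ runValuation C u t → .cell ∈ runValuation C u t :=
    fun ⟨n, i, h, _⟩ => ⟨n, i, h⟩
  have hop (b : B) (t : ℚ) : .op b ∈ runValuation C u t → .cell ∈ runValuation C u t :=
    fun ⟨n, i, h, _⟩ => ⟨n, i, h⟩
  have hpos (n i : ℕ) : 0 < cellTime n i := n.cast_nonneg.trans_lt (lt_cellTime n i)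
  constructor
  · rintro t (rfl : t = 0) t' ht' (rfl : t' = 0)
    exact lt_irrefl _ ht'
  · rintro _ ⟨n, i, rfl⟩
    exact ⟨0, hpos n i, rfl⟩
  · exact fun t h => h
  · rintro _ ⟨n, i, rfl⟩
    exact (atPreviousCell_runValuation_iff C u (fun _ => id) n i).2 ⟨n, i + 1, rfl⟩
  · rintro t ⟨n, i, h⟩
    exact ⟨n + 1, i, cellTime_eq_add_one h⟩
  · rintro _ ⟨n, i, rfl⟩ ⟨t', ht', (rfl : t' = 0)⟩
    cases n with
    | zero => linarith [cellTime_le 0 i, Nat.cast_zero (R := ℚ)]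
    | succ n => exact ⟨n, i, by rw [cellTime_succ, add_sub_cancel_right]⟩
  · exact fun t a => hstate a t
  · exact fun t b => hop b t
  · rintro _ a h ⟨n, i, rfl⟩
    exact ⟨n, i, rfl, h n i rfl⟩
  · rintro _ a ⟨n, i, rfl⟩ h
    rw [atPreviousCell_runValuation_iff C u (hstate a), state_mem_runValuation] at h
    exact (next_mem_runValuation C u).2 h
  · rintro t ⟨n, h⟩
    exact ⟨n + 1, cellTime_eq_add_one h⟩
  · rintro _ a ⟨n, rfl⟩ h
    rw [state_mem_runValuation] at h
    rw [op_mem_runValuation, h]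
  · rintro _ b ⟨n, i, rfl, h⟩
    rw [atPreviousCell_runValuation_iff C u (hop b), op_mem_runValuation, h]
  · rintro t b a₁ a₂ a₃ ⟨n, i, ht, hb⟩ h₁ h₂ h₃
    rw [ht] at h₁ h₂ h₃
    rw [state_mem_runValuation] at h₁
    rw [atPreviousCell_runValuation_iff C u (hstate a₂), state_mem_runValuation] at h₂
    rw [atPreviousCell_runValuation_iff C u (hnext a₃), next_mem_runValuation] at h₃
    rw [cellTime_eq_add_one ht, atPreviousCell_runValuation_iff C u (hstate _),
      state_mem_runValuation, BroadcastAutomaton.row, hb, h₁, h₂, h₃]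
  · rintro t b a₁ a₂ ⟨m, hm⟩ ⟨n, i, ht, hb⟩ h₁ h₂
    obtain ⟨rfl, rfl⟩ := cellTime_inj (hm.symm.trans (cellTime_eq_add_one ht))
    rw [ht] at h₁ h₂
    rw [state_mem_runValuation] at h₁
    rw [atPreviousCell_runValuation_iff C u (hstate a₂), state_mem_runValuation] at h₂
    rw [hm, state_mem_runValuation, BroadcastAutomaton.row, hb, h₁, h₂]
  · rintro t b hb ⟨n, i, -, h⟩
    exact hH n (h ▸ hb)

theorem matchesInput_runValuation (a₀ a₁ a₂ a₃ : A) (x : ℕ) :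
    MatchesInput a₀ a₁ a₂ a₃ x (runValuation C (inputRow a₀ a₁ a₂ a₃ x)) := by
  have h0 (i : ℕ) : (1 / ((i : ℚ) + 1)) = cellTime 0 i := by simp [cellTime]
  have h1 : (1 : ℚ) = cellTime 0 0 := by simp [cellTime]
  have h2 (i : ℕ) : (1 / ((i : ℚ) + 2)) = cellTime 0 (i + 1) := by
    rw [← h0]; push_cast; ring
  have h3 : (1 / ((x : ℚ) + 3)) = cellTime 0 (x + 2) := by
    rw [← h0]; push_cast; ring
  have h4 : (1 / 2 : ℚ) = cellTime 0 1 := by norm_num [cellTime]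
  constructor
  · rfl
  · exact ⟨0, h1⟩
  · exact fun i _ => ⟨0, i, h0 i⟩
  · intro i _ t ht ht'
    rw [h2] at ht
    rw [h0] at ht'
    exact not_cell_runValuation C (inputRow a₀ a₁ a₂ a₃ x) ht ht'
  · intro n i h
    obtain ⟨rfl, rfl⟩ := cellTime_inj (h1.symm.trans h)
    rfl
  · intro n i h
    obtain ⟨rfl, rfl⟩ := cellTime_inj (h4.symm.trans h)
    rfl
  · rintro t ht ht' n i rfl
    rw [h3, cellTime_lt_iff] at ht
    rw [h4, cellTime_lt_iff] at ht'
    obtain rfl : n = 0 := by omega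
    simp only [BroadcastAutomaton.row, inputRow]
    rw [if_neg (by omega), if_neg (by omega), if_pos (by omega)]
  · rintro t ht ht' n i rfl
    rw [h3, ← not_lt, cellTime_lt_iff] at ht'
    obtain rfl : n = 0 := by omega
    simp only [BroadcastAutomaton.row, inputRow]
    rw [if_neg (by omega), if_neg (by omega), if_neg (by omega)]

end

/-- The cells of the initial row of a grid: an infinite sequence, backwards in time. -/
theorem IsGrid.exists_cells {C : BroadcastAutomaton A B} {H : Set B}
    {V : ℚ → Set (GridProp A B)} (hV : IsGrid C H V) (h₁ : .cell ∈ V 1) :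
    ∃ c : ℕ → ℚ, c 0 = 1 ∧ (∀ i, .cell ∈ V (c i)) ∧ (∀ i, c (i + 1) < c i) ∧
      ∀ i s, c (i + 1) < s → s < c i → .cell ∉ V s := by
  choose! p hlt hp hfree using hV.previous
  have hc (i : ℕ) : .cell ∈ V (p^[i] 1) := by
    induction i with
    | zero => exact h₁
    | succ i ih => rw [Function.iterate_succ_apply']; exact hp _ ih
  refine ⟨fun i => p^[i] 1, rfl, hc, fun i => ?_, fun i => ?_⟩ <;>
    simp only [Function.iterate_succ_apply']
  · exact hlt _ (hc i)
  · exact hfree _ (hc i)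

/-- A valuation may contain spurious cells or several states per cell, but the constraints force the
true run into it: `start` confines cells to positive times, dataset facts fix the first `x + 3`
cells, and every later cell of the sequence `c` is blank wherever it lies. Shifting `c` by `n` gives
row `n`. -/
theorem IsGrid.op_not_mem {C : BroadcastAutomaton A B} {H : Set B}
    {V : ℚ → Set (GridProp A B)} (hV : IsGrid C H V) {a₀ a₁ a₂ a₃ : A} {x : ℕ}
    (hD : MatchesInput a₀ a₁ a₂ a₃ x V) (n : ℕ) :
    C.op (C.row (inputRow a₀ a₁ a₂ a₃ x) n 0) ∉ H := by
  have hstart (t : ℚ) (ht : .start ∈ V t) : t = 0 := by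
    rcases lt_trichotomy t 0 with h | h | h
    · exact absurd ht (hV.start_unique 0 hD.start t h)
    · exact h
    · exact absurd hD.start (hV.start_unique t ht 0 h)
  have hpos (t : ℚ) (ht : .cell ∈ V t) : 0 < t := by
    obtain ⟨t', ht', hs⟩ := hV.start_lt_cell t ht
    rwa [hstart t' hs] at ht'
  obtain ⟨c, hc0, hcell, hanti, hfree⟩ :=
    hV.exists_cells (by simpa using hD.cell 0 (by omega))
  have hc (i : ℕ) (hi : i < x + 3) : c i = 1 / ((i : ℚ) + 1) := by
    induction i with
    | zero => simpa using hc0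
    | succ i ih =>
      have ih := ih (by omega)
      have e : ((i + 1 : ℕ) : ℚ) + 1 = i + 2 := by push_cast; ring
      have hlt : 1 / ((i : ℚ) + 2) < 1 / ((i : ℚ) + 1) :=
        one_div_lt_one_div_of_lt (by positivity) (by linarith)
      have hmem := hD.cell (i + 1) hi
      rw [e] at hmem ⊢
      rcases lt_trichotomy (c (i + 1)) (1 / ((i : ℚ) + 2)) with h | h | h
      · exact absurd hmem (hfree i _ h (ih ▸ hlt))
      · exact h
      · exact absurd (hcell (i + 1))
          (hV.gap _ (hD.gap i (by omega) _ h (ih ▸ hanti i)))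
  have hcanti : StrictAnti c := strictAnti_nat_of_succ_lt hanti
  have hrow0 (i : ℕ) : .state (inputRow a₀ a₁ a₂ a₃ x i) ∈ V (c i) := by
    refine hV.input _ _ ?_ (hcell i)
    unfold inputRow
    split_ifs with h₀ h₁ h₂
    · rw [h₀, hc0]; exact hD.input₀
    · rw [h₁, hc 1 (by omega)]; norm_num; simpa using hD.input₁
    · rw [hc i (by omega)]
      refine hD.input₂ _ (one_div_lt_one_div_of_lt (by positivity) ?_)
        (one_div_lt_one_div_of_lt (by positivity) ?_)
      · have : (i : ℚ) < x + 2 := by exact_mod_cast h₂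
        linarith
      · have : (1 : ℚ) < i := by exact_mod_cast (by omega : 1 < i)
        linarith
    · refine hD.input₃ _ (hpos _ (hcell i)) ?_
      have := hc (x + 2) (by omega)
      rw [show ((x + 2 : ℕ) : ℚ) + 1 = x + 3 by push_cast; ring] at this
      rw [← this]
      exact hcanti.antitone (by omega)
  have hcells (n : ℕ) : (∀ i, .cell ∈ V (n + c i)) ∧
      ∀ i s, n + c (i + 1) < s → s < n + c i → .cell ∉ V s := by
    induction n with
    | zero => simpa using ⟨hcell, hfree⟩
    | succ n ih =>
      refine ⟨fun i => hV.cell_copy _ ?_, fun i s h₁ h₂ hs => ?_⟩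
      · rw [show ((n + 1 : ℕ) : ℚ) + c i - 1 = n + c i by push_cast; ring]
        exact ih.1 i
      · push_cast at h₁ h₂
        -- Positivity puts `0` strictly before `s - 1`, so a stray cell at `s` would come from a
        -- stray cell one row earlier.
        have : (0 : ℚ) < n + c (i + 1) := hpos _ (ih.1 (i + 1))
        exact ih.2 i (s - 1) (by linarith) (by linarith)
          (hV.cell_origin s hs ⟨0, by linarith, hD.start⟩)
  have hprev {n i : ℕ} {q : GridProp A B} (h : .cell ∈ V (n + c i) → q ∈ V (n + c (i + 1))) :
      AtPreviousCell V q (n + c i) :=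
    ⟨n + c (i + 1), by linarith [hanti i], h ((hcells n).1 i), (hcells n).2 i⟩
  have hprev' {n i : ℕ} {q : GridProp A B} (hq : ∀ t, q ∈ V t → .cell ∈ V t)
      (h : AtPreviousCell V q (n + c i)) : q ∈ V (n + c (i + 1)) := by
    obtain ⟨t', ht', hqt, hf⟩ := h
    rcases lt_trichotomy t' (n + c (i + 1)) with h | h | h
    · exact absurd ((hcells n).1 (i + 1)) (hf _ h (by linarith [hanti i]))
    · exact h ▸ hqt
    · exact absurd (hq _ hqt) ((hcells n).2 i _ h ht')
  have hedge (n : ℕ) : .edge ∈ V (n + c 0) := by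
    induction n with
    | zero => simpa [hc0] using hD.edge
    | succ n ih =>
      refine hV.edge_copy _ ?_
      rwa [show ((n + 1 : ℕ) : ℚ) + c 0 - 1 = n + c 0 by push_cast; ring]
  set u := inputRow a₀ a₁ a₂ a₃ x
  -- The operation starts at the edge and travels back in time, cell by cell.
  have hops (n : ℕ) (h : .state (C.row u n 0) ∈ V (n + c 0)) (i : ℕ) :
      .op (C.op (C.row u n 0)) ∈ V (n + c i) := by
    induction i with
    | zero => exact hV.edge_op _ _ (hedge n) h
    | succ i ih => exact hprev' (fun t => hV.op_cell t _) (hV.op_copy _ _ ih)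
  have hrow (n : ℕ) : ∀ i, .state (C.row u n i) ∈ V (n + c i) := by
    induction n with
    | zero => simpa [BroadcastAutomaton.row] using hrow0
    | succ n ih =>
      have e (i : ℕ) : ((n + 1 : ℕ) : ℚ) + c i - 1 = n + c i := by push_cast; ring
      have hop := hops n (ih 0)
      rintro (_ | i)
      · refine hV.edge_state _ _ _ _ (hedge (n + 1)) ?_ ?_ ?_ <;> rw [e]
        · exact hop 0
        · exact ih 0
        · exact hprev fun _ => ih 1
      · refine hprev' (fun t => hV.state_cell t _) (hV.inner _ _ _ _ _ ?_ ?_ ?_ ?_) <;> rw [e]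
        · exact hop i
        · exact ih i
        · exact hprev fun _ => ih (i + 1)
        · exact hprev fun _ => hV.next _ _ ((hcells n).1 (i + 1)) (hprev fun _ => ih (i + 2))
  exact fun hH => hV.avoid _ _ hH (hops n (hrow n 0) 0)

end

/-! ### Datasets for the initial rows and their computability -/

/-- The code of the fraction `1 / (k + 1)`. -/
def unitFraction (k : ℕ) : Fraction := (1, k.succPNat)

theorem value_unitFraction (k : ℕ) : Fraction.value (unitFraction k) = 1 / ((k : ℚ) + 1) := by
  simp [Fraction.value, unitFraction]

theorem primrec_unitFraction : Primrec unitFraction :=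
  -- The encoding of `ℕ+` unfolds to `natPred`, which undoes `succPNat`.
  .pair (.const 1) (Primrec.encode_iff.1 (Primrec.id.of_eq fun k => (Nat.natPred_succPNat k).symm))

section
variable {A B : Type}

/-- The codes of the facts that describe the initial row `inputRow a₀ a₁ a₂ a₃ x`. -/
def inputFacts (N : GridProp A B → ℕ) (a₀ a₁ a₂ a₃ : A) (x : ℕ) : List FactCode :=
  [(N .start, some (true, 0, 1), some (true, 0, 1)),
    (N .edge, some (true, unitFraction 0), some (true, unitFraction 0)),
    (N (.input a₀), some (true, unitFraction 0), some (true, unitFraction 0)),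
    (N (.input a₁), some (true, unitFraction 1), some (true, unitFraction 1)),
    (N (.input a₂), some (false, unitFraction (x + 2)), some (false, unitFraction 1)),
    (N (.input a₃), some (false, 0, 1), some (true, unitFraction (x + 2)))] ++
  ((List.range (x + 3)).map fun i =>
    (N .cell, some (true, unitFraction i), some (true, unitFraction i))) ++
  ((List.range (x + 2)).map fun i =>
    (N .gap, some (false, unitFraction (i + 1)), some (false, unitFraction i)))

theorem computable_inputFacts (N : GridProp A B → ℕ) (a₀ a₁ a₂ a₃ : A) :
    Computable (inputFacts N a₀ a₁ a₂ a₃) := by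
  have hend {α : Type} [Primcodable α] (b : Bool) {f : α → ℕ} (hf : Primrec f) :
      Primrec fun a => (some (b, unitFraction (f a)) : EndpointCode) :=
    Primrec.option_some.comp (.pair (.const b) (primrec_unitFraction.comp hf))
  refine Primrec.to_comp (Primrec.list_append.comp
    (Primrec.list_append.comp ?_ ?_) ?_)
  · have h2 : Primrec fun x : ℕ => x + 2 := Primrec.nat_add.comp .id (.const 2)
    refine Primrec.list_cons.comp (.const _) <| Primrec.list_cons.comp (.const _) <|
      Primrec.list_cons.comp (.const _) <| Primrec.list_cons.comp (.const _) <|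
      Primrec.list_cons.comp ?_ <| Primrec.list_cons.comp ?_ (.const _)
    · exact .pair (.const _) (.pair (hend _ h2) (.const _))
    · exact .pair (.const _) (.pair (.const _) (hend _ h2))
  · exact Primrec.list_map
      (Primrec.list_range.comp (Primrec.nat_add.comp .id (.const 3)))
      (Primrec.pair (.const _) (.pair (hend _ .snd) (hend _ .snd))).to₂
  · exact Primrec.list_map
      (Primrec.list_range.comp (Primrec.nat_add.comp .id (.const 2)))
      (Primrec.pair (.const _) (.pair (hend _ (Primrec.succ.comp .snd)) (hend _ .snd))).to₂

theorem forall_mem_inputFacts (N : GridProp A B → ℕ) (a₀ a₁ a₂ a₃ : A) (x : ℕ)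
    (p : ℕ × Interval → Prop) :
    (∀ F ∈ (inputFacts N a₀ a₁ a₂ a₃ x).map FactCode.decode, p F) ↔
      p (N .start, ⟨.incl 0, .incl 0⟩) ∧ p (N .edge, ⟨.incl 1, .incl 1⟩) ∧
      p (N (.input a₀), ⟨.incl 1, .incl 1⟩) ∧ p (N (.input a₁), ⟨.incl (1 / 2), .incl (1 / 2)⟩) ∧
      p (N (.input a₂), ⟨.excl (1 / ((x : ℚ) + 3)), .excl (1 / 2)⟩) ∧
      p (N (.input a₃), ⟨.excl 0, .incl (1 / ((x : ℚ) + 3))⟩) ∧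
      (∀ i < x + 3, p (N .cell, ⟨.incl (1 / ((i : ℚ) + 1)), .incl (1 / ((i : ℚ) + 1))⟩)) ∧
      ∀ i < x + 2, p (N .gap, ⟨.excl (1 / ((i : ℚ) + 2)), .excl (1 / ((i : ℚ) + 1))⟩) := by
  have h0 : Fraction.value (0, 1) = 0 := by simp [Fraction.value]
  have e2 : (1 : ℚ) + 1 = 2 := by norm_num
  have e (q : ℚ) : q + 1 + 1 = q + 2 := by ring
  have e' (q : ℚ) : q + 2 + 1 = q + 3 := by ring
  simp only [inputFacts, List.map_append, List.map_cons, List.map_nil, List.map_map,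
    List.mem_append, List.mem_cons, List.not_mem_nil, or_false, List.mem_map, List.mem_range,
    or_imp, forall_and, forall_eq, forall_exists_index, and_imp, forall_apply_eq_imp_iff₂,
    Function.comp_apply, FactCode.decode, EndpointCode.decode, value_unitFraction, h0, Nat.cast_zero,
    zero_add, div_one, Nat.cast_one, Nat.cast_add, Nat.cast_ofNat, e2, e, e', and_assoc]

open Classical in
/-- The dataset that describes the initial row `inputRow a₀ a₁ a₂ a₃ x`. -/
noncomputable def inputDataset (N : GridProp A B → ℕ) (a₀ a₁ a₂ a₃ : A) (x : ℕ) : Dataset ℕ where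
  facts := ((inputFacts N a₀ a₁ a₂ a₃ x).map FactCode.decode).toFinset
  nonempty F hF := by
    have hx : 0 < 1 / ((x : ℚ) + 3) := by positivity
    have hx' : 1 / ((x : ℚ) + 3) < 1 / 2 :=
      one_div_lt_one_div_of_lt (by norm_num) (by linarith [x.cast_nonneg (α := ℚ)])
    refine (forall_mem_inputFacts N a₀ a₁ a₂ a₃ x fun F => F.2.points.Nonempty).2
      ⟨⟨_, le_rfl, le_rfl⟩, ⟨_, le_rfl, le_rfl⟩, ⟨_, le_rfl, le_rfl⟩, ⟨_, le_rfl, le_rfl⟩,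
        exists_between hx', ⟨_, hx, le_rfl⟩, fun i _ => ⟨_, le_rfl, le_rfl⟩, fun i _ => ?_⟩ F
        (List.mem_toFinset.1 hF)
    exact exists_between (one_div_lt_one_div_of_lt (by positivity) (by linarith))

open Classical in
theorem represents_inputDataset (N : GridProp A B → ℕ) (a₀ a₁ a₂ a₃ : A) (x : ℕ) :
    Represents (inputFacts N a₀ a₁ a₂ a₃ x) (inputDataset N a₀ a₁ a₂ a₃ x) :=
  fun _ => List.mem_toFinset

theorem forall_mem_inputDataset (N : GridProp A B → ℕ) (a₀ a₁ a₂ a₃ : A) (x : ℕ)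
    (p : ℕ × Interval → Prop) :
    (∀ F ∈ (inputDataset N a₀ a₁ a₂ a₃ x).facts, p F) ↔
      ∀ F ∈ (inputFacts N a₀ a₁ a₂ a₃ x).map FactCode.decode, p F :=
  forall_congr' fun F => by rw [represents_inputDataset N a₀ a₁ a₂ a₃ x F]

theorem bounded_inputDataset (N : GridProp A B → ℕ) (a₀ a₁ a₂ a₃ : A) (x : ℕ) :
    (inputDataset N a₀ a₁ a₂ a₃ x).Bounded := by
  rw [Dataset.Bounded, forall_mem_inputDataset, forall_mem_inputFacts]
  simp [Interval.Bounded]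

theorem exists_of_mem_inputDataset (N : GridProp A B → ℕ) (a₀ a₁ a₂ a₃ : A) (x : ℕ) :
    ∀ F ∈ (inputDataset N a₀ a₁ a₂ a₃ x).facts, ∃ q, F.1 = N q := by
  rw [forall_mem_inputDataset, forall_mem_inputFacts]
  exact ⟨⟨_, rfl⟩, ⟨_, rfl⟩, ⟨_, rfl⟩, ⟨_, rfl⟩, ⟨_, rfl⟩, ⟨_, rfl⟩, fun _ _ => ⟨_, rfl⟩,
    fun _ _ => ⟨_, rfl⟩⟩

theorem model_inputDataset_iff {code : GridProp A B ⊕ GridProp A B → ℕ} (hcode : code.Injective)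
    (a₀ a₁ a₂ a₃ : A) (x : ℕ) (V : ℚ → Set (GridProp A B)) :
    (inputDataset (code ∘ .inl) a₀ a₁ a₂ a₃ x).Model (literals code V) ↔
      MatchesInput a₀ a₁ a₂ a₃ x V := by
  have hpt (q : GridProp A B) (s : ℚ) :
      (∀ t ∈ (Interval.mk (.incl s) (.incl s)).points, q ∈ V t) ↔ q ∈ V s :=
    ⟨fun h => h s ⟨le_rfl, le_rfl⟩, fun h t ht => le_antisymm ht.1 ht.2 ▸ h⟩
  rw [Dataset.Model, forall_mem_inputDataset, forall_mem_inputFacts]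
  simp only [Function.comp_apply, mem_literals_inl hcode, hpt]
  constructor
  · rintro ⟨h₁, h₂, h₃, h₄, h₅, h₆, h₇, h₈⟩
    exact ⟨h₁, h₂, h₇, fun i hi t ht ht' => h₈ i hi t ⟨ht, ht'⟩, h₃, h₄,
      fun t ht ht' => h₅ t ⟨ht, ht'⟩, fun t ht ht' => h₆ t ⟨ht, ht'⟩⟩
  · rintro ⟨h₁, h₂, h₇, h₈, h₃, h₄, h₅, h₆⟩
    exact ⟨h₁, h₂, h₃, h₄, fun t ht => h₅ t ht.1 ht.2, fun t ht => h₆ t ht.1 ht.2, h₇,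
      fun i hi t ht => h₈ i hi t ht.1 ht.2⟩

theorem noFuture_gridConstraints {P : Type} (code : GridProp A B ⊕ GridProp A B → P)
    (C : BroadcastAutomaton A B) (H : Set B) :
    ∀ c ∈ gridConstraints code C H, (∀ M ∈ c.1, M.NoFuture) ∧ ∀ M ∈ c.2, M.NoFuture := by
  simp only [gridConstraints, Set.mem_union, Set.mem_insert_iff, Set.mem_singleton_iff,
    Set.mem_range, Set.mem_image, or_imp, forall_and, forall_eq, forall_exists_index, and_imp,
    forall_apply_eq_imp_iff, forall_apply_eq_imp_iff₂, List.mem_cons, List.not_mem_nil, or_false,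
    MetricAtom.NoFuture, gridAtom, previousAtom, oneBefore]
  simp

end

end DatalogMTL

/-! ### The reduction -/

theorem mainTheorem1 :
    ∃ Pi : DatalogMTL.Program ℕ, Pi.ForwardPropagating ∧ ¬ DatalogMTL.DecidableOnBoundedData Pi := by
  open DatalogMTL in
  obtain ⟨A, B, _, _, C, H, a₀, a₁, a₂, a₃, hC⟩ := exists_broadcastAutomaton_not_computablePred
  obtain ⟨code, hcode⟩ := Countable.exists_injective_nat (GridProp A B ⊕ GridProp A B)
  have hfin : (guessAndCheck code (gridConstraints code C H)).Finite :=
    ((Set.finite_range _).union (Set.finite_range _)).union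
      ((finite_gridConstraints code C H).image _)
  refine ⟨hfin.toFinset, fun r hr => ?_, ?_⟩
  · rw [Set.Finite.mem_toFinset] at hr
    rcases hr with (⟨q, rfl⟩ | ⟨q, rfl⟩) | ⟨c, hc, rfl⟩
    · simp [choiceRule, MetricAtom.NoBoxMinus, MetricAtom.NoFuture]
    · simp [choiceRule, MetricAtom.NoBoxMinus, MetricAtom.NoFuture]
    · exact ⟨trivial, noFuture_gridConstraints code C H c hc⟩
  rintro ⟨f, hf, hdec⟩
  have hstable (x : ℕ) :
      HasStableModel hfin.toFinset (inputDataset (code ∘ .inl) a₀ a₁ a₂ a₃ x) ↔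
        ¬ ∃ n, C.op (C.row (inputRow a₀ a₁ a₂ a₃ x) n 0) ∈ H := by
    rw [hasStableModel_guessAndCheck_iff hcode hfin.coe_toFinset
      (exists_of_mem_inputDataset (code ∘ .inl) a₀ a₁ a₂ a₃ x)]
    simp only [model_inputDataset_iff hcode, respects_gridConstraints_iff hcode]
    constructor
    · rintro ⟨V, hD, hV⟩ ⟨n, hn⟩
      exact hV.op_not_mem hD n hn
    · intro h
      exact ⟨_, matchesInput_runValuation C a₀ a₁ a₂ a₃ x,
        isGrid_runValuation C _ fun n hn => h ⟨n, hn⟩⟩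
  have key (x : ℕ) := hdec _ (bounded_inputDataset (code ∘ .inl) a₀ a₁ a₂ a₃ x) _
    (represents_inputDataset (code ∘ .inl) a₀ a₁ a₂ a₃ x)
  choose g hg hg' using key
  have hgc : Computable g :=
    (hf.comp (computable_inputFacts (code ∘ .inl) a₀ a₁ a₂ a₃)).of_eq fun x =>
      Part.eq_some_iff.2 (hg x)
  -- A stable model means that no halting operation occurs, hence the negated answer.
  refine hC (ComputablePred.computable_iff.2
    ⟨fun x => !g x, Primrec.not.to_comp.comp hgc, funext fun x => propext ?_⟩)
  have := (hg' x).trans (hstable x)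
  cases h : g x <;> simp_all
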